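/- Let $T$ be a complete first-order theory in a language $L$, let $M\models T$ and let $A\subseteq M$ be a set of parameters. For a tuple of variables $x$ let $L_x(A)$ be the Boolean algebra of $L$-formulas in $x$ with parameters in $A$, up to equivalence in $M$. For a partitioned $L$-formula $\varphi(x,y)$ and $A\subseteq B\subseteq M$ let $L_{\varphi,x}^B(A)\subseteq L_x(A)$ be the subalgebra of those formulas over $A$ that are equivalent to a Boolean combination of instances $\varphi(x,b)$ with $b$ a tuple from $B$. For $B=M$ its elements are the $\varphi$-formulas over $A$. The formula $\varphi(x,y)$ is stable if in no model of $T$ are there tuples $(a_i,b_i)_{i<\omega}$ such that $\varphi(a_i,b_j)$ holds if and only if $i<j$. The theory $T$ is totally transcendental (t.t.) if in no model $N$ of $T$ is there a binary tree of consistent formulas over $N$ in a finite tuple of variables (that is, consistent formulas indexed by the finite $0$-$1$ sequences, where the two children of each node imply it and are mutually inconsistent). A Keisler measure on one of these Boolean algebras is a finitely additive probability measure on it. A complete type $p$ of one of these Boolean algebras is a maximal consistent set of formulas from it, and $p(\psi)$ is $1$ if $\psi\in p$ and $0$ otherwise. 1. Suppose that $\varphi(x,y)$ is stable, $A\subseteq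 B\subseteq M$, and $\mu$ is a Keisler measure on $L_{\varphi,x}^B(A)$ (in particular, $\mu$ may be a Keisler measure on the $\varphi$-formulas over $A$, the case $B=M$). Then there are a sequence $(p_i)_{i<\omega}$ of complete types of $L_{\varphi,x}^B(A)$ (for $B=M$: complete $\varphi$-types over $A$), not necessarily distinct, and positive real numbers $(\alpha_i)_{i<\omega}$ such that $\sum_{i<\omega}\alpha_i=1$ and $\mu(\psi)=\sum_{i<\omega}\alpha_i\,p_i(\psi)$ for every $\psi\in L_{\varphi,x}^B(A)$. 2. Suppose that $T$ is t.t., $x$ is a finite tuple of variables, and $\mu$ is a Keisler measure on $L_x(A)$. Then there are a sequence $(p_i)_{i<\omega}$ of complete types over $A$ in $x$, not necessarily distinct, and positive real numbers $(\alpha_i)_{i<\omega}$ such that $\sum_{i<\omega}\alpha_i=1$ and $\mu(\psi)=\sum_{i<\omega}\alpha_i\,p_i(\psi)$ for every $\psi\in L_x(A)$. -/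

import Mathlib

open FirstOrder FirstOrder.Language

universe u v w

namespace KeislerSum

section BooleanAlgebras

/-- A finitely additive probability measure on a Boolean algebra. When the algebra is the algebra
of formulas in `x` over `A`, or of `φ`-formulas over `A`, this is a Keisler measure. -/
structure KeislerMeasure (𝔹 : Type*) [BooleanAlgebra 𝔹] where
  toFun : 𝔹 → ℝ
  nonneg' : ∀ ψ, 0 ≤ toFun ψ
  top' : toFun ⊤ = 1
  sup' : ∀ ψ χ, Disjoint ψ χ → toFun (ψ ⊔ χ) = toFun ψ + toFun χ

instance {𝔹 : Type*} [BooleanAlgebra 𝔹] : CoeFun (KeislerMeasure 𝔹) (fun _ => 𝔹 → ℝ) :=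
  ⟨KeislerMeasure.toFun⟩

/-- A set of elements of an algebra of formulas is consistent if the conjunction of any finitely
many of its members is satisfiable, i.e. is not the zero of the algebra. -/
def Consistent {𝔹 : Type*} [BooleanAlgebra 𝔹] (p : Set 𝔹) : Prop :=
  ∀ s : Finset 𝔹, (s : Set 𝔹) ⊆ p → s.inf id ≠ ⊥

/-- Complete types with respect to an algebra of formulas: maximal consistent sets. -/
def TypeSpace (𝔹 : Type*) [BooleanAlgebra 𝔹] : Type _ :=
  {p : Set 𝔹 // Maximal Consistent p}

open Classical in
/-- The value `p(ψ)` of a complete type at a formula, in `{0, 1}`. -/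
noncomputable def TypeSpace.value {𝔹 : Type*} [BooleanAlgebra 𝔹] (p : TypeSpace 𝔹) (ψ : 𝔹) : ℝ :=
  if ψ ∈ p.1 then 1 else 0

end BooleanAlgebras

section Formulas

variable {L : FirstOrder.Language.{u, v}}

/-- The partitioned formula `φ(x, y)` (with `x` indexed by `α` and `y` by `β`) is stable in `T`: in
no model of `T` are there `a₀, a₁, …` and `b₀, b₁, …` such that `φ(aᵢ, bⱼ)` holds iff `i < j`. -/
def StableFormula (T : L.Theory) {α : Type*} {β : Type*} (φ : L.Formula (α ⊕ β)) : Prop :=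
  ∀ N : Theory.ModelType.{u, v, max u v w} T,
    ¬ ∃ (a : ℕ → α → N) (b : ℕ → β → N), ∀ i j : ℕ, φ.Realize (Sum.elim (a i) (b j)) ↔ i < j

/-- `T` is totally transcendental: in no model `N` of `T` is there a binary tree of consistent
formulas with parameters in `N`, in any finite tuple of variables. Nodes of the full binary tree
are finite lists of bits, and the children of `s` are `false :: s` and `true :: s`. -/
def TotallyTranscendental (T : L.Theory) : Prop :=
  ∀ (N : Theory.ModelType.{u, v, max u v w} T) (n : ℕ),
    ¬ ∃ D : List Bool → L.DefinableSet (Set.univ : Set N) (Fin n),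
      (∀ s, D s ≠ ⊥) ∧ (∀ s i, D (i :: s) ≤ D s) ∧ (∀ s, Disjoint (D (false :: s)) (D (true :: s)))

variable {M : Type w} [L.Structure M] {α : Type*} {β : Type*}

/-- The sets defined by the instances `φ(x, b)` of `φ(x, y)` with `b` a tuple from `B`. -/
def instancesOf (φ : L.Formula (α ⊕ β)) (B : Set M) : Set (Set (α → M)) :=
  {S | ∃ b : β → M, (∀ j, b j ∈ B) ∧ S = {a | φ.Realize (Sum.elim a b)}}

/-- The Boolean algebra of those formulas in `x` over `A`, up to equivalence, that are equivalent
to a Boolean combination of instances `φ(x, b)` with `b` from `B`. -/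
noncomputable def phiFormulas (φ : L.Formula (α ⊕ β)) (A B : Set M) :
    BooleanSubalgebra (L.DefinableSet A α) where
  carrier := {D | (D : Set (α → M)) ∈ BooleanSubalgebra.closure (instancesOf φ B)}
  supClosed' := fun _ hD _ hE =>
    (BooleanSubalgebra.closure (instancesOf φ B)).supClosed' hD hE
  infClosed' := fun _ hD _ hE =>
    (BooleanSubalgebra.closure (instancesOf φ B)).infClosed' hD hE
  compl_mem' := (BooleanSubalgebra.closure (instancesOf φ B)).compl_mem'
  bot_mem' := (BooleanSubalgebra.closure (instancesOf φ B)).bot_mem'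

end Formulas

end KeislerSum

namespace KeislerSum

/-! ### Measures on Boolean algebras without binary trees. -/

section Measures

variable {𝔹 : Type*} [BooleanAlgebra 𝔹]

/-! Give each complete type the infimum of the measure over its members as its mass. Finitely many
types can be separated by disjoint elements, so subtracting all these atoms leaves a nonnegative
additive function, `diffuse`. An element of positive remainder splits into two disjoint pieces of
positive remainder (`diffuse_split`), so a nonzero remainder grows a binary tree. Both claims
therefore reduce to the absence of binary trees (`exists_hasSum_types`).

For t.t. theories this is the definition, after transport to an isomorphic model. For a stable
formula, choose a point in each node of a supposed tree and an ultrafilter along each branch.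
Without ladders, the instances lying in such an ultrafilter are determined by finite data on the
countable set of chosen points (`exists_finset_determining`). Hence only countably many traces
occur, while the continuum many branches have distinct traces (`not_isBinaryTree_of_no_ladder`). -/

/-- A full binary tree of nonzero elements of a Boolean algebra in which siblings are disjoint. -/
def IsBinaryTree (D : List Bool → 𝔹) : Prop :=
  (∀ s, D s ≠ ⊥) ∧ (∀ s i, D (i :: s) ≤ D s) ∧ ∀ s, Disjoint (D (false :: s)) (D (true :: s))

theorem Consistent.inf_ne_bot {p : Set 𝔹} (hp : Consistent p) {x y : 𝔹} (hx : x ∈ p)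
    (hy : y ∈ p) : x ⊓ y ≠ ⊥ := by
  classical
  have h := hp {x, y} (by simp [Set.insert_subset_iff, hx, hy])
  simpa using h

theorem maximal_consistent_of_inf_compl {p : Set 𝔹} (htop : ⊤ ∈ p) (hbot : ⊥ ∉ p)
    (hinf : ∀ x ∈ p, ∀ y ∈ p, x ⊓ y ∈ p) (hcompl : ∀ x, x ∈ p ∨ xᶜ ∈ p) :
    Maximal Consistent p := by
  refine ⟨fun s hs h => hbot ?_, fun q hq hpq x hx => ?_⟩
  · rw [← h]
    exact Finset.inf_induction (p := (· ∈ p)) htop hinf hs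
  · refine (hcompl x).resolve_right fun h => ?_
    exact hq.inf_ne_bot hx (hpq h) (inf_compl_self x)

namespace TypeSpace

/-- An element meeting every finite meet of members of a complete type belongs to it. -/
theorem mem_of_forall_inf_ne_bot (p : TypeSpace 𝔹) {x : 𝔹}
    (h : ∀ s : Finset 𝔹, (s : Set 𝔹) ⊆ p.1 → s.inf id ⊓ x ≠ ⊥) : x ∈ p.1 := by
  classical
  refine p.2.2 (y := insert x p.1) (fun s hs hbot => ?_) (Set.subset_insert _ _)
    (Set.mem_insert _ _)
  refine h (s.erase x) (fun y hy => ?_) (le_bot_iff.1 ?_)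
  · have hy' := Finset.mem_erase.1 (Finset.mem_coe.1 hy)
    exact (hs hy'.2).resolve_left hy'.1
  · rw [← hbot]
    refine Finset.le_inf fun y hy => ?_
    by_cases hyx : y = x
    · exact hyx ▸ inf_le_right
    · exact inf_le_left.trans (Finset.inf_le (f := id) (Finset.mem_erase.2 ⟨hyx, hy⟩))

theorem mem_of_le (p : TypeSpace 𝔹) {x y : 𝔹} (hx : x ∈ p.1) (hxy : x ≤ y) : y ∈ p.1 := by
  classical
  refine p.mem_of_forall_inf_ne_bot fun s hs h => p.2.1 (insert x s) ?_ ?_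
  · simp [Set.insert_subset_iff, hx, hs]
  · refine le_bot_iff.1 ((?_ : _ ≤ _).trans h.le)
    rw [Finset.inf_insert]
    exact le_inf inf_le_right (inf_le_left.trans hxy)

theorem inf_mem (p : TypeSpace 𝔹) {x y : 𝔹} (hx : x ∈ p.1) (hy : y ∈ p.1) : x ⊓ y ∈ p.1 := by
  classical
  refine p.mem_of_forall_inf_ne_bot fun s hs h => p.2.1 (insert x (insert y s)) ?_ ?_
  · simp [Set.insert_subset_iff, hx, hy, hs]
  · rw [Finset.inf_insert, Finset.inf_insert, ← h]
    simp only [id]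
    rw [← inf_assoc, inf_comm]

theorem compl_mem_of_notMem (p : TypeSpace 𝔹) {x : 𝔹} (hx : x ∉ p.1) : xᶜ ∈ p.1 := by
  classical
  by_contra hc
  have key : ∀ z : 𝔹, z ∉ p.1 → ∃ s : Finset 𝔹, (s : Set 𝔹) ⊆ p.1 ∧ s.inf id ⊓ z = ⊥ := by
    intro z hz
    by_contra! h
    exact hz (p.mem_of_forall_inf_ne_bot h)
  obtain ⟨s, hs, hsx⟩ := key x hx
  obtain ⟨t, ht, htx⟩ := key _ hc
  refine p.2.1 (s ∪ t) (by simp [hs, ht]) (le_bot_iff.1 ?_)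
  rw [Finset.inf_union]
  have h1 : s.inf id ≤ xᶜ := le_compl_iff_disjoint_right.2 (disjoint_iff.2 hsx)
  have h2 : t.inf id ≤ x := disjoint_compl_right_iff.1 (disjoint_iff.2 htx)
  exact (inf_le_inf h1 h2).trans (compl_inf_self x).le

theorem notMem_of_disjoint (p : TypeSpace 𝔹) {x y : 𝔹} (hxy : Disjoint x y) (hx : x ∈ p.1) :
    y ∉ p.1 :=
  fun hy => p.2.1.inf_ne_bot hx hy hxy.eq_bot

theorem compl_mem_iff (p : TypeSpace 𝔹) {x : 𝔹} : xᶜ ∈ p.1 ↔ x ∉ p.1 :=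
  ⟨p.notMem_of_disjoint disjoint_compl_left, p.compl_mem_of_notMem⟩

theorem sup_mem_iff (p : TypeSpace 𝔹) {x y : 𝔹} : x ⊔ y ∈ p.1 ↔ x ∈ p.1 ∨ y ∈ p.1 := by
  refine ⟨fun h => ?_, fun h => h.elim (p.mem_of_le · le_sup_left) (p.mem_of_le · le_sup_right)⟩
  by_contra! hn
  have := p.inf_mem (p.compl_mem_of_notMem hn.1) (p.compl_mem_of_notMem hn.2)
  rw [← compl_sup] at this
  exact p.compl_mem_iff.1 this h

theorem top_mem (p : TypeSpace 𝔹) : ⊤ ∈ p.1 := by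
  by_contra h
  refine p.2.1.inf_ne_bot (p.compl_mem_of_notMem h) (p.compl_mem_of_notMem h) ?_
  simp

theorem value_of_mem {p : TypeSpace 𝔹} {x : 𝔹} (h : x ∈ p.1) : p.value x = 1 := if_pos h

theorem value_of_notMem {p : TypeSpace 𝔹} {x : 𝔹} (h : x ∉ p.1) : p.value x = 0 := if_neg h

theorem value_nonneg (p : TypeSpace 𝔹) (x : 𝔹) : 0 ≤ p.value x := by
  unfold value; split_ifs <;> norm_num

theorem value_sup (p : TypeSpace 𝔹) {x y : 𝔹} (hxy : Disjoint x y) :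
    p.value (x ⊔ y) = p.value x + p.value y := by
  by_cases hx : x ∈ p.1
  · rw [value_of_mem (p.sup_mem_iff.2 (.inl hx)), value_of_mem hx,
      value_of_notMem (p.notMem_of_disjoint hxy hx), add_zero]
  · by_cases hy : y ∈ p.1
    · rw [value_of_mem (p.sup_mem_iff.2 (.inr hy)), value_of_mem hy, value_of_notMem hx, zero_add]
    · rw [value_of_notMem hx, value_of_notMem hy, value_of_notMem, add_zero]
      simp [p.sup_mem_iff, hx, hy]

theorem exists_mem_notMem_of_ne {p q : TypeSpace 𝔹} (h : p ≠ q) : ∃ x ∈ p.1, x ∉ q.1 := by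
  by_contra! hpq
  exact h (Subtype.ext (Set.Subset.antisymm hpq (p.2.2 q.2.1 hpq)))

/-- A complete type is separated by one of its members from finitely many other types. -/
theorem exists_mem_forall_notMem (p : TypeSpace 𝔹) (s : Finset (TypeSpace 𝔹)) (hp : p ∉ s) :
    ∃ x ∈ p.1, ∀ q ∈ s, x ∉ q.1 := by
  classical
  induction s using Finset.induction_on with
  | empty => exact ⟨⊤, p.top_mem, by simp⟩
  | insert q s _ ih =>
    rw [Finset.mem_insert, not_or] at hp
    obtain ⟨x, hx, hxs⟩ := ih hp.2
    obtain ⟨y, hy, hyq⟩ := exists_mem_notMem_of_ne hp.1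
    refine ⟨x ⊓ y, p.inf_mem hx hy, fun r hr hxy => ?_⟩
    obtain rfl | hr := Finset.mem_insert.1 hr
    · exact hyq (r.mem_of_le hxy inf_le_right)
    · exact hxs r hr (r.mem_of_le hxy inf_le_left)

end TypeSpace

/-- If every element of positive value of a monotone additive function splits into two elements of
positive value, then the function vanishes or the Boolean algebra contains a binary tree. -/
theorem exists_isBinaryTree {ν : 𝔹 → ℝ} (hbot : ν ⊥ = 0) (htop : 0 < ν ⊤)
    (hsplit : ∀ x, 0 < ν x → ∃ y z, y ≤ x ∧ z ≤ x ∧ Disjoint y z ∧ 0 < ν y ∧ 0 < ν z) :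
    ∃ D : List Bool → 𝔹, IsBinaryTree D := by
  choose f g hf hg hfg hνf hνg using hsplit
  let E : List Bool → {x : 𝔹 // 0 < ν x} := fun s =>
    s.rec ⟨⊤, htop⟩ fun i _ x =>
      bif i then ⟨f x.1 x.2, hνf _ _⟩ else ⟨g x.1 x.2, hνg _ _⟩
  refine ⟨fun s => (E s).1, fun s h => ?_, fun s i => ?_, fun s => ?_⟩
  · have := (E s).2
    exact this.ne' ((congrArg ν h).trans hbot)
  · cases i
    · exact hg _ _
    · exact hf _ _
  · exact (hfg _ _).symm

namespace KeislerMeasure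

variable (μ : KeislerMeasure 𝔹)

theorem mono {x y : 𝔹} (h : x ≤ y) : μ x ≤ μ y := by
  have := μ.sup' x (y \ x) disjoint_sdiff_self_right
  rw [sup_sdiff_cancel_right h] at this
  linarith [μ.nonneg' (y \ x)]

theorem bot : μ ⊥ = 0 := by
  have := μ.sup' ⊥ ⊥ disjoint_bot_left
  rw [bot_sup_eq] at this
  linarith

/-- The mass of a complete type, i.e. the infimum of the measures of its members. -/
noncomputable def mass (p : TypeSpace 𝔹) : ℝ := ⨅ x : p.1, μ x

theorem bddBelow_range (p : TypeSpace 𝔹) : BddBelow (Set.range fun x : p.1 => μ x) :=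
  ⟨0, by rintro _ ⟨x, rfl⟩; exact μ.nonneg' _⟩

theorem mass_nonneg (p : TypeSpace 𝔹) : 0 ≤ μ.mass p :=
  Real.iInf_nonneg fun x => μ.nonneg' x

theorem mass_le {p : TypeSpace 𝔹} {x : 𝔹} (hx : x ∈ p.1) : μ.mass p ≤ μ x :=
  ciInf_le (μ.bddBelow_range p) ⟨x, hx⟩

theorem le_mass {p : TypeSpace 𝔹} {c : ℝ} (h : ∀ x ∈ p.1, c ≤ μ x) : c ≤ μ.mass p :=
  have : Nonempty p.1 := ⟨⟨⊤, p.top_mem⟩⟩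
  le_ciInf fun x => h x x.2

theorem sum_mass_mul_value_le (s : Finset (TypeSpace 𝔹)) (x : 𝔹) :
    ∑ p ∈ s, μ.mass p * p.value x ≤ μ x := by
  classical
  induction s using Finset.induction_on generalizing x with
  | empty => simpa using μ.nonneg' x
  | insert p s hp ih =>
    -- Cut `x` along `y`: the part inside pays for `p`, the part outside pays for the types in `s`.
    obtain ⟨y, hy, hys⟩ := p.exists_mem_forall_notMem s hp
    rw [Finset.sum_insert hp]
    have hsum : ∑ q ∈ s, μ.mass q * q.value x = ∑ q ∈ s, μ.mass q * q.value (x ⊓ yᶜ) := by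
      refine Finset.sum_congr rfl fun q hq => ?_
      have hyq := q.compl_mem_of_notMem (hys q hq)
      by_cases hx : x ∈ q.1
      · rw [TypeSpace.value_of_mem hx, TypeSpace.value_of_mem (q.inf_mem hx hyq)]
      · rw [TypeSpace.value_of_notMem hx,
          TypeSpace.value_of_notMem fun h => hx (q.mem_of_le h inf_le_left)]
    have hp : μ.mass p * p.value x ≤ μ (x ⊓ y) := by
      by_cases hx : x ∈ p.1
      · rw [TypeSpace.value_of_mem hx, mul_one]
        exact μ.mass_le (p.inf_mem hx hy)
      · rw [TypeSpace.value_of_notMem hx, mul_zero]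
        exact μ.nonneg' _
    have hadd := μ.sup' (x ⊓ y) (x ⊓ yᶜ)
      (disjoint_compl_right.mono inf_le_right inf_le_right)
    rw [← inf_sup_left, sup_compl_eq_top, inf_top_eq] at hadd
    rw [hsum, hadd]
    exact add_le_add hp (ih _)

theorem summable_mass_mul_value (x : 𝔹) : Summable fun p => μ.mass p * p.value x :=
  summable_of_sum_le (fun p => mul_nonneg (μ.mass_nonneg p) (p.value_nonneg x))
    (μ.sum_mass_mul_value_le · x)

/-- What is left of a measure after the masses of all complete types are removed. -/
noncomputable def diffuse (x : 𝔹) : ℝ := μ x - ∑' p, μ.mass p * p.value x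

theorem diffuse_nonneg (x : 𝔹) : 0 ≤ μ.diffuse x :=
  sub_nonneg.2 ((μ.summable_mass_mul_value x).tsum_le_of_sum_le (μ.sum_mass_mul_value_le · x))

theorem diffuse_sup {x y : 𝔹} (h : Disjoint x y) :
    μ.diffuse (x ⊔ y) = μ.diffuse x + μ.diffuse y := by
  have hsum : ∑' p, μ.mass p * p.value (x ⊔ y) =
      ∑' p, μ.mass p * p.value x + ∑' p, μ.mass p * p.value y := by
    rw [← (μ.summable_mass_mul_value x).tsum_add (μ.summable_mass_mul_value y)]
    exact tsum_congr fun p => by rw [p.value_sup h, mul_add]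
  unfold diffuse
  rw [hsum, μ.sup' x y h]
  ring

theorem diffuse_mono {x y : 𝔹} (h : x ≤ y) : μ.diffuse x ≤ μ.diffuse y := by
  have := μ.diffuse_sup (x := x) (y := y \ x) disjoint_sdiff_self_right
  rw [sup_sdiff_cancel_right h] at this
  linarith [μ.diffuse_nonneg (y \ x)]

theorem diffuse_bot : μ.diffuse ⊥ = 0 := by
  have := μ.diffuse_sup (x := ⊥) (y := ⊥) disjoint_bot_left
  rw [bot_sup_eq] at this
  linarith

/-- If `x` did not split, the elements meeting `x` in positive remainder would form a complete type,
and every member of it would have measure at least its mass plus `μ.diffuse x`, against the mass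
being an infimum. -/
theorem diffuse_split {x : 𝔹} (hx : 0 < μ.diffuse x) :
    ∃ y z, y ≤ x ∧ z ≤ x ∧ Disjoint y z ∧ 0 < μ.diffuse y ∧ 0 < μ.diffuse z := by
  by_contra! hns
  have hadd : ∀ y, μ.diffuse x = μ.diffuse (x ⊓ y) + μ.diffuse (x ⊓ yᶜ) := fun y => by
    rw [← μ.diffuse_sup (disjoint_compl_right.mono inf_le_right inf_le_right),
      ← inf_sup_left, sup_compl_eq_top, inf_top_eq]
  have hzero : ∀ y, 0 < μ.diffuse (x ⊓ y) → μ.diffuse (x ⊓ yᶜ) = 0 := fun y hy =>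
    (hns _ _ inf_le_left inf_le_left (disjoint_compl_right.mono inf_le_right inf_le_right)
      hy).antisymm (μ.diffuse_nonneg _)
  let p : TypeSpace 𝔹 := ⟨{y | 0 < μ.diffuse (x ⊓ y)}, by
    refine maximal_consistent_of_inf_compl ?_ ?_ ?_ ?_
    · simpa using hx
    · simp [diffuse_bot]
    · intro y hy z hz
      have h1 := hadd y
      have h2 := hzero y hy
      have h3 := hzero z hz
      have h4 : μ.diffuse (x ⊓ y ⊓ zᶜ) ≤ μ.diffuse (x ⊓ zᶜ) :=
        μ.diffuse_mono (inf_le_inf_right _ inf_le_left)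
      have h5 : μ.diffuse (x ⊓ y) = μ.diffuse (x ⊓ y ⊓ z) + μ.diffuse (x ⊓ y ⊓ zᶜ) := by
        rw [← μ.diffuse_sup (disjoint_compl_right.mono inf_le_right inf_le_right),
          ← inf_sup_left, sup_compl_eq_top, inf_top_eq]
      rw [inf_assoc] at h5
      change 0 < μ.diffuse (x ⊓ (y ⊓ z))
      linarith
    · intro y
      by_contra! h
      simp only [Set.mem_ofPred_eq, not_lt] at h
      linarith [hadd y]⟩
  have hle : μ.mass p + μ.diffuse x ≤ μ.mass p := by
    refine μ.le_mass fun y hy => ?_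
    have h1 : μ.diffuse x ≤ μ.diffuse y := by
      have := hadd y
      rw [hzero y hy, add_zero] at this
      rw [this]
      exact μ.diffuse_mono inf_le_right
    have h2 : μ.mass p * p.value y ≤ ∑' q, μ.mass q * q.value y :=
      (μ.summable_mass_mul_value y).le_tsum p fun q _ =>
        mul_nonneg (μ.mass_nonneg q) (q.value_nonneg y)
    rw [TypeSpace.value_of_mem hy, mul_one] at h2
    have h3 : μ.diffuse y = μ y - ∑' q, μ.mass q * q.value y := rfl
    linarith
  linarith

theorem hasSum_mass_mul_value (hD : ¬ ∃ D : List Bool → 𝔹, IsBinaryTree D) (x : 𝔹) :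
    HasSum (fun p => μ.mass p * p.value x) (μ x) := by
  have htop : μ.diffuse ⊤ ≤ 0 := by
    by_contra! h
    exact hD (exists_isBinaryTree μ.diffuse_bot h fun x => μ.diffuse_split)
  have hx : μ.diffuse x = 0 :=
    ((μ.diffuse_mono le_top).trans htop).antisymm (μ.diffuse_nonneg x)
  rw [sub_eq_zero.1 hx]
  exact (μ.summable_mass_mul_value x).hasSum

/-- A finitely additive probability measure on a Boolean algebra without binary trees is a
countable convex combination of complete types. -/
theorem exists_hasSum_types (hD : ¬ ∃ D : List Bool → 𝔹, IsBinaryTree D) :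
    ∃ (p : ℕ → TypeSpace 𝔹) (c : ℕ → ℝ),
      (∀ i, 0 < c i) ∧ HasSum c 1 ∧ ∀ x, HasSum (fun i => c i * (p i).value x) (μ x) := by
  classical
  let S : Set (TypeSpace 𝔹) := {p | μ.mass p ≠ 0}
  have hmass : HasSum μ.mass 1 := by
    have := μ.hasSum_mass_mul_value hD ⊤
    rw [μ.top'] at this
    simpa only [TypeSpace.value_of_mem (TypeSpace.top_mem _), mul_one] using this
  have hS : S.Countable := hmass.summable.countable_support
  have hne : S.Nonempty := by
    by_contra! h
    have h0 : μ.mass = fun _ => 0 := funext fun p => by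
      by_contra hp
      exact (h ▸ (show p ∈ S from hp) : p ∈ (∅ : Set (TypeSpace 𝔹)))
    rw [h0] at hmass
    exact zero_ne_one (hasSum_zero.unique hmass)
  have : Countable S := hS.to_subtype
  have : Nonempty S := hne.to_subtype
  -- `S` may be finite, so each type is repeated infinitely often, its mass being shared out with
  -- geometric weights; this keeps every coefficient positive.
  obtain ⟨e⟩ : Nonempty (ℕ ≃ S × ℕ) := nonempty_equiv_of_countable
  have hgeom : HasSum (fun n : ℕ => (1 / 2 : ℝ) / 2 ^ n) 1 := by
    simpa only [div_div, div_mul_eq_mul_div, one_mul] using hasSum_geometric_two' (1 : ℝ)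
  have key : ∀ x, HasSum (fun i => μ.mass (e i).1 * ((1 / 2 : ℝ) / 2 ^ (e i).2) *
      ((e i).1 : TypeSpace 𝔹).value x) (μ x) := by
    intro x
    have h1 : HasSum (fun p : S => μ.mass p * (p : TypeSpace 𝔹).value x) (μ x) := by
      refine (hasSum_subtype_iff_of_support_subset fun p hp => ?_).2 (μ.hasSum_mass_mul_value hD x)
      exact left_ne_zero_of_mul hp
    have h2 := h1.mul hgeom (h1.summable.mul_of_nonneg hgeom.summable
      (fun p => mul_nonneg (μ.mass_nonneg _) (TypeSpace.value_nonneg _ _))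
      (fun n => by positivity))
    rw [mul_one, ← e.hasSum_iff] at h2
    have hfun : (fun i => μ.mass (e i).1 * ((1 / 2 : ℝ) / 2 ^ (e i).2) *
        ((e i).1 : TypeSpace 𝔹).value x) = _ :=
      funext fun i => mul_right_comm (μ.mass (e i).1) _ _
    rw [hfun]
    exact h2
  refine ⟨fun i => (e i).1, fun i => μ.mass (e i).1 * ((1 / 2 : ℝ) / 2 ^ (e i).2),
    fun i => ?_, ?_, key⟩
  · exact mul_pos ((μ.mass_nonneg _).lt_of_ne' (e i).1.2) (by positivity)
  · have := key ⊤
    rw [μ.top'] at this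
    simpa only [TypeSpace.value_of_mem (TypeSpace.top_mem _), mul_one] using this

end KeislerMeasure

end Measures

/-! ### Ladders, traces of ultrafilters and binary trees. -/

section Ladders

open Filter

/-- A ladder for `R` increasing to the right. -/
def HasLadder {X Y : Type*} (R : X → Y → Prop) : Prop :=
  ∃ (a : ℕ → X) (b : ℕ → Y), ∀ i j, R (a i) (b j) ↔ i < j

/-- A ladder for `R` increasing to the left. -/
def HasReverseLadder {X Y : Type*} (R : X → Y → Prop) : Prop :=
  ∃ (a : ℕ → X) (b : ℕ → Y), ∀ i j, R (a i) (b j) ↔ j ≤ i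

/-- Greedy choice: the finitely many conditions imposed by earlier indices hold jointly on a large
set, and a nonprincipal ultrafilter also allows the next index to be larger. -/
theorem exists_strictMono_of_eventually {c : ℕ → ℕ → Prop}
    (h : ∀ᶠ i in (hyperfilter ℕ : Filter ℕ), ∀ᶠ j in (hyperfilter ℕ : Filter ℕ), c i j) :
    ∃ g : ℕ → ℕ, StrictMono g ∧ ∀ i j, i < j → c (g i) (g j) := by
  obtain ⟨g, -, hg⟩ := exists_seq_of_forall_finset_exists
    (fun i => ∀ᶠ j in (hyperfilter ℕ : Filter ℕ), c i j) (fun i j => i < j ∧ c i j) (by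
      intro s hs
      have h1 : ∀ᶠ j in (hyperfilter ℕ : Filter ℕ), ∀ i ∈ s, i < j ∧ c i j := by
        refine (eventually_all_finset s).2 fun i hi => ?_
        refine Eventually.and ?_ (hs i hi)
        have : ∀ᶠ j in (atTop : Filter ℕ), i < j := eventually_gt_atTop i
        exact (Nat.hyperfilter_le_atTop) this
      exact (h.and h1).exists)
  exact ⟨g, fun i j hij => (hg i j hij).1, fun i j hij => (hg i j hij).2⟩

/-- Ramsey's theorem for pairs of natural numbers and two colours. -/
theorem exists_strictMono_homogeneous (c : ℕ → ℕ → Prop) :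
    ∃ g : ℕ → ℕ, StrictMono g ∧
      ((∀ i j, i < j → c (g i) (g j)) ∨ ∀ i j, i < j → ¬ c (g i) (g j)) := by
  by_cases h : ∀ᶠ i in (hyperfilter ℕ : Filter ℕ), ∀ᶠ j in (hyperfilter ℕ : Filter ℕ), c i j
  · obtain ⟨g, hg, hc⟩ := exists_strictMono_of_eventually h
    exact ⟨g, hg, .inl hc⟩
  -- Ultrafilter quantifiers commute with negation, so the other colour holds in the double limit.
  · simp only [← Ultrafilter.eventually_not] at h
    obtain ⟨g, hg, hc⟩ := exists_strictMono_of_eventually h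
    exact ⟨g, hg, .inr hc⟩

variable {X Y : Type*} {R : X → Y → Prop}

/-- Without ladders, the trace of an ultrafilter on the instances of `R` is determined by finitely
many points of any member of the ultrafilter. -/
theorem exists_finset_determining (h₁ : ¬ HasLadder R) (h₂ : ¬ HasReverseLadder R)
    (U : Ultrafilter X) {X₀ : Set X} (hX₀ : X₀ ∈ U) :
    ∃ F : Finset X₀, ∀ y y', (∀ x ∈ F, R x y ↔ R x y') →
      (∀ᶠ x in (U : Filter X), R x y) → ∀ᶠ x in (U : Filter X), R x y' := by
  classical
  by_contra! hF
  -- Triples `(x, y, y')` with `y` in the trace and `y'` outside it: earlier points do not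
  -- distinguish `y` from `y'`, while the point itself and all later ones do.
  obtain ⟨t, ht, htt⟩ := exists_seq_of_forall_finset_exists
    (fun t : X₀ × Y × Y => (∀ᶠ x in (U : Filter X), R x t.2.1) ∧
      (∀ᶠ x in (U : Filter X), ¬ R x t.2.2) ∧ R t.1 t.2.1 ∧ ¬ R t.1 t.2.2)
    (fun t t' => (R t.1 t'.2.1 ↔ R t.1 t'.2.2) ∧ R t'.1 t.2.1 ∧ ¬ R t'.1 t.2.2) (by
      intro s hs
      obtain ⟨y, y', hyy, hy, hy'⟩ := hF (s.image Prod.fst)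
      have hs' : ∀ᶠ x in (U : Filter X), ∀ t ∈ s, R x t.2.1 ∧ ¬ R x t.2.2 :=
        (eventually_all_finset s).2 fun t ht => (hs t ht).1.and (hs t ht).2.1
      obtain ⟨x, hx, hxs, hxy, hxy'⟩ :=
        ((show ∀ᶠ x in (U : Filter X), x ∈ X₀ from hX₀).and (hs'.and (hy.and hy'))).exists
      refine ⟨(⟨x, hx⟩, y, y'), ⟨hy, hy', hxy, hxy'⟩, fun t ht => ⟨?_, hxs t ht⟩⟩
      exact hyy _ (Finset.mem_image_of_mem _ ht))
  -- Only `R xᵢ yⱼ` for `i < j` is still free. If it holds, the `y'` form a ladder; if it fails, the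
  -- `y` form a reverse one.
  obtain ⟨g, hg, hc | hc⟩ := exists_strictMono_homogeneous fun i j => R (t i).1 (t j).2.1
  · refine h₁ ⟨fun i => (t (g i)).1, fun j => (t (g j)).2.2, fun i j => ⟨fun h => ?_, fun h => ?_⟩⟩
    · by_contra! hij
      obtain hij | rfl := hij.lt_or_eq
      · exact (htt _ _ (hg hij)).2.2 h
      · exact (ht _).2.2.2 h
    · exact (htt _ _ (hg h)).1.1 (hc i j h)
  · refine h₂ ⟨fun i => (t (g i)).1, fun j => (t (g j)).2.1, fun i j => ⟨fun h => ?_, fun h => ?_⟩⟩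
    · by_contra! hij
      exact hc i j hij h
    · obtain hij | rfl := h.lt_or_eq
      · exact (htt _ _ (hg hij)).2.1
      · exact (ht _).2.2.1

/-- Two ultrafilters that agree on the generators agree on the generated algebra of sets. -/
theorem mem_iff_mem_of_mem_closure {U V : Ultrafilter X} {I : Set (Set X)}
    (h : ∀ S ∈ I, S ∈ U ↔ S ∈ V) {S : Set X} (hS : S ∈ BooleanSubalgebra.closure I) :
    S ∈ U ↔ S ∈ V := by
  induction hS using BooleanSubalgebra.closure_bot_sup_induction with
  | mem S hS => exact h S hS
  | bot => simp [Ultrafilter.empty_notMem]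
  | sup S _ S' _ ih ih' =>
    change S ∪ S' ∈ U ↔ S ∪ S' ∈ V
    rw [Ultrafilter.union_mem_iff, Ultrafilter.union_mem_iff, ih, ih']
  | compl S _ ih => rw [Ultrafilter.compl_mem_iff_notMem, Ultrafilter.compl_mem_iff_notMem, ih]

/-- The node of level `n` on a branch of the binary tree. -/
def branch (σ : ℕ → Bool) (n : ℕ) : List Bool :=
  n.rec [] fun k s => σ k :: s

theorem branch_congr {σ τ : ℕ → Bool} {n : ℕ} (h : ∀ k < n, σ k = τ k) :
    branch σ n = branch τ n := by
  induction n with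
  | zero => rfl
  | succ n ih =>
    change σ n :: branch σ n = τ n :: branch τ n
    rw [h n n.lt_succ_self, ih fun k hk => h k (hk.trans n.lt_succ_self)]

/-- Without ladders, the algebra of sets generated by the instances of `R` has no binary tree. -/
theorem not_isBinaryTree_of_no_ladder (h₁ : ¬ HasLadder R) (h₂ : ¬ HasReverseLadder R)
    (D : List Bool → Set X)
    (hD : ∀ s, D s ∈ BooleanSubalgebra.closure (Set.range fun y => {x | R x y})) :
    ¬ IsBinaryTree D := by
  classical
  rintro ⟨hne, hle, hdisj⟩
  choose x hx using fun s => Set.nonempty_iff_ne_empty.2 (hne s)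
  let U : (ℕ → Bool) → Ultrafilter X := fun σ => Ultrafilter.of (map (fun n => x (branch σ n)) atTop)
  have hanti : ∀ σ, Antitone fun n => D (branch σ n) := fun σ =>
    antitone_nat_of_succ_le fun n => hle _ _
  have hUD : ∀ σ n, D (branch σ n) ∈ U σ := fun σ n => by
    refine Ultrafilter.of_le _ (mem_map.2 (mem_atTop_sets.2 ⟨n, fun m hm => ?_⟩))
    exact hanti σ hm (hx _)
  have hU₀ : ∀ σ, Set.range x ∈ U σ := fun σ =>
    Ultrafilter.of_le _ (mem_map.2 (univ_mem' fun n => Set.mem_range_self _))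
  choose F hF using fun σ => exists_finset_determining h₁ h₂ (U σ) (hU₀ σ)
  -- The determining set with the subsets of it cut out by instances in the trace. Since `F σ` lies
  -- in the countable range of `x`, there are only countably many codes.
  let code : (ℕ → Bool) → Finset (Set.range x) × Finset (Finset (Set.range x)) := fun σ =>
    (F σ, (F σ).powerset.filter fun G =>
      ∃ y, (∀ᶠ z in (U σ : Filter X), R z y) ∧ (F σ).filter (fun z : Set.range x => R z y) = G)
  have hcode : ∀ σ τ, code σ = code τ → ∀ y, (∀ᶠ z in (U σ : Filter X), R z y) →
      ∀ᶠ z in (U τ : Filter X), R z y := by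
    intro σ τ h y hy
    obtain ⟨hFF, hGG⟩ := Prod.ext_iff.1 h
    simp only [code] at hFF hGG
    have hmem : (F σ).filter (fun z : Set.range x => R z y) ∈ (F σ).powerset.filter fun G =>
        ∃ y, (∀ᶠ z in (U σ : Filter X), R z y) ∧ (F σ).filter (fun z : Set.range x => R z y) = G :=
      Finset.mem_filter.2 ⟨Finset.mem_powerset.2 (Finset.filter_subset _ _), y, hy, rfl⟩
    rw [hGG] at hmem
    obtain ⟨-, y', hy', hyy⟩ := Finset.mem_filter.1 hmem
    refine hF τ y' y (fun z hz => ?_) hy'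
    have := Finset.ext_iff.1 hyy z
    rw [hFF] at this
    simpa [hz] using this
  have hinj : Function.Injective code := by
    intro σ τ h
    by_contra hne
    have hex : ∃ n, σ n ≠ τ n := Function.ne_iff.1 hne
    have hlt : ∀ k < Nat.find hex, σ k = τ k := fun k hk => not_not.1 (Nat.find_min hex hk)
    have hn := Nat.find_spec hex
    set n := Nat.find hex
    have hbr := branch_congr hlt
    -- Equal codes give equal traces, so `U τ` would contain both of the disjoint nodes at which the
    -- branches part.
    have hagree : ∀ S ∈ Set.range (fun y => {x | R x y}), S ∈ U σ ↔ S ∈ U τ := by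
      rintro _ ⟨y, rfl⟩
      exact ⟨hcode σ τ h y, hcode τ σ h.symm y⟩
    have hσ : D (σ n :: branch σ n) ∈ U τ :=
      (mem_iff_mem_of_mem_closure hagree (hD _)).1 (hUD σ (n + 1))
    have hτ : D (τ n :: branch σ n) ∈ U τ := by
      rw [hbr]
      exact hUD τ (n + 1)
    have hdis : Disjoint (D (σ n :: branch σ n)) (D (τ n :: branch σ n)) := by
      revert hn
      cases σ n <;> cases τ n <;> intro hn
      · exact absurd rfl hn
      · exact hdisj _
      · exact (hdisj _).symm
      · exact absurd rfl hn
    have := inter_mem hσ hτ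
    rw [hdis.inter_eq] at this
    exact (U τ).empty_notMem this
  have : Countable (Set.range x) := (Set.countable_range x).to_subtype
  have hcount : Countable (ℕ → Bool) := hinj.countable
  have hle := Cardinal.mk_le_aleph0_iff.2 hcount
  simp only [Cardinal.mk_pi, Cardinal.mk_bool, Cardinal.prod_const, Cardinal.mk_nat,
    Cardinal.lift_ofNat, Cardinal.lift_aleph0] at hle
  exact (Cardinal.cantor _).not_ge hle

end Ladders

/-! ### Passage between models, and absence of binary trees of formulas. -/

section Models

variable {L : FirstOrder.Language.{u, v}} {T : L.Theory} {M : Type w} [L.Structure M] {α β : Type*}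

theorem definable_preimage_of_equiv {N : Type*} [L.Structure N] (e : M ≃[L] N) {A : Set M}
    {S : Set (α → M)} (hS : A.Definable L S) :
    (Set.univ : Set N).Definable L {x : α → N | e.symm ∘ x ∈ S} := by
  rw [Set.definable_iff_exists_formula_sum] at hS ⊢
  obtain ⟨φ, rfl⟩ := hS
  refine ⟨φ.relabel (Sum.map (fun a : A => ⟨e a, trivial⟩) id), ?_⟩
  ext x
  have : (e : M → N) ∘ Sum.elim (fun a : A => (a : M)) (e.symm ∘ x) =
      Sum.elim (fun n : (Set.univ : Set N) => (n : N)) x ∘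
        Sum.map (fun a : A => ⟨e a, trivial⟩) id := by
    ext z
    cases z <;> simp
  simp only [Set.mem_ofPred_eq, Formula.realize_relabel, ← this, StrongHomClass.realize_formula]

variable [Nonempty M] [M ⊨ T]

/-- Stability and total transcendence quantify over models in the universe `max u v w`, whereas `M`
lives in `w`. -/
theorem exists_ulift_model (T : L.Theory) (M : Type w) [L.Structure M] [Nonempty M] [M ⊨ T] :
    ∃ N : Theory.ModelType.{u, v, max u v w} T, Nonempty (M ≃[L] N) :=
  ⟨(Theory.ModelType.of T M).ulift, ⟨Equiv.inducedStructureEquiv (L := L) _⟩⟩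

theorem StableFormula.not_hasLadder {φ : L.Formula (α ⊕ β)}
    (hφ : StableFormula.{u, v, w} T φ) (M : Type w) [L.Structure M] [Nonempty M] [M ⊨ T] :
    ¬ HasLadder fun (a : α → M) (b : β → M) => φ.Realize (Sum.elim a b) := by
  rintro ⟨a, b, hab⟩
  obtain ⟨N, ⟨e⟩⟩ := exists_ulift_model T M
  refine hφ N ⟨fun i => e ∘ a i, fun j => e ∘ b j, fun i j => ?_⟩
  rw [← Sum.comp_elim, StrongHomClass.realize_formula]
  exact hab i j

/-- A reverse ladder in a structure gives a ladder in its ultrapower. -/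
theorem StableFormula.not_hasReverseLadder {φ : L.Formula (α ⊕ β)}
    (hφ : StableFormula.{u, v, w} T φ) (M : Type w) [L.Structure M] [Nonempty M] [M ⊨ T] :
    ¬ HasReverseLadder fun (a : α → M) (b : β → M) => φ.Realize (Sum.elim a b) := by
  rintro ⟨a, b, hab⟩
  let N : Type w := (Filter.hyperfilter ℕ : Filter ℕ).Product fun _ => M
  have : N ⊨ T := ⟨fun ψ hψ => (Ultraproduct.sentence_realize ψ).2
    (Filter.Eventually.of_forall fun _ => Theory.realize_sentence_of_mem T hψ)⟩
  -- Finite segments of the ladder are read backwards from `n`: once `i + j ≤ n`, the condition `n +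
  -- 1 - j ≤ n - i` says exactly `i < j`.
  refine hφ.not_hasLadder N ⟨fun i x => ((fun n => a (n - i) x : ℕ → M) : N),
    fun j x => ((fun n => b (n + 1 - j) x : ℕ → M) : N), fun i j => ?_⟩
  have hlarge : ∀ᶠ n in (Filter.hyperfilter ℕ : Filter ℕ), i + j ≤ n :=
    Nat.hyperfilter_le_atTop (Filter.eventually_ge_atTop _)
  have hcast := Ultraproduct.realize_formula_cast (u := Filter.hyperfilter ℕ) φ
    (fun z n => Sum.elim (a (n - i)) (b (n + 1 - j)) z)
  refine Iff.trans (iff_of_eq (congrArg φ.Realize ?_)) (hcast.trans ⟨?_, ?_⟩)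
  · ext z
    cases z <;> rfl
  · intro h
    obtain ⟨n, hn, hr⟩ := (hlarge.and h).exists
    have := (hab _ _).1 hr
    omega
  · intro hij
    filter_upwards [hlarge] with n hn
    exact (hab _ _).2 (by omega)

theorem StableFormula.not_isBinaryTree {φ : L.Formula (α ⊕ β)}
    (hφ : StableFormula.{u, v, w} T φ) (A B : Set M) :
    ¬ ∃ D : List Bool → phiFormulas φ A B, IsBinaryTree D := by
  rintro ⟨D, hne, hle, hdisj⟩
  refine not_isBinaryTree_of_no_ladder (hφ.not_hasLadder M) (hφ.not_hasReverseLadder M)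
    (fun s => ((D s : L.DefinableSet A α) : Set (α → M))) (fun s => ?_) ⟨fun s h => ?_, hle, ?_⟩
  · refine BooleanSubalgebra.closure_mono ?_ (D s).2
    rintro _ ⟨b, -, rfl⟩
    exact ⟨b, rfl⟩
  · exact hne s (Subtype.ext (SetLike.coe_injective h))
  · intro s
    have := congrArg (fun E : phiFormulas φ A B => ((E : L.DefinableSet A α) : Set (α → M)))
      (hdisj s).eq_bot
    exact Set.disjoint_iff_inter_eq_empty.2 this

theorem TotallyTranscendental.not_isBinaryTree (hT : TotallyTranscendental.{u, v, w} T)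
    [Finite α] (A : Set M) : ¬ ∃ D : List Bool → L.DefinableSet A α, IsBinaryTree D := by
  rintro ⟨D, hne, hle, hdisj⟩
  obtain ⟨N, ⟨e⟩⟩ := exists_ulift_model T M
  obtain ⟨n, ⟨f⟩⟩ := Finite.exists_equiv_fin α
  -- Surjectivity keeps the pulled-back nodes nonempty.
  have hsurj : Function.Surjective fun x : Fin n → N => e.symm ∘ x ∘ f := fun y =>
    ⟨e ∘ y ∘ f.symm, by ext; simp⟩
  refine hT N n ⟨fun s => ⟨_, (definable_preimage_of_equiv e (D s).2).preimage_comp f⟩,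
    fun s h => ?_, fun s i x hx => hle s i hx, fun s => ?_⟩
  · refine hne s (SetLike.coe_injective (Set.eq_empty_of_forall_notMem fun y hy => ?_))
    obtain ⟨x, rfl⟩ := hsurj y
    have : x ∈ (⊥ : L.DefinableSet (Set.univ : Set N) (Fin n)) := h ▸ hy
    exact this
  · intro E h₁ h₂ x hx
    have : (e.symm ∘ x ∘ f) ∈ D (false :: s) ⊓ D (true :: s) := ⟨h₁ hx, h₂ hx⟩
    rw [(hdisj s).eq_bot] at this
    exact this

end Models

end KeislerSum

theorem mainTheorem10 {L : FirstOrder.Language.{u, v}} (T : L.Theory) (hT : T.IsComplete)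
    (M : Type w) [L.Structure M] [Nonempty M] [M ⊨ T] (A : Set M)
    {α β : Type*} :
    (∀ φ : L.Formula (α ⊕ β), KeislerSum.StableFormula.{u, v, w} T φ →
      ∀ B : Set M, A ⊆ B → ∀ μ : KeislerSum.KeislerMeasure (KeislerSum.phiFormulas φ A B),
        ∃ (p : ℕ → KeislerSum.TypeSpace (KeislerSum.phiFormulas φ A B)) (c : ℕ → ℝ),
          (∀ i, 0 < c i) ∧ HasSum c 1 ∧ ∀ ψ, HasSum (fun i => c i * (p i).value ψ) (μ ψ)) ∧
    (Finite α → KeislerSum.TotallyTranscendental.{u, v, w} T →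
      ∀ μ : KeislerSum.KeislerMeasure (L.DefinableSet A α),
        ∃ (p : ℕ → KeislerSum.TypeSpace (L.DefinableSet A α)) (c : ℕ → ℝ),
          (∀ i, 0 < c i) ∧ HasSum c 1 ∧ ∀ ψ, HasSum (fun i => c i * (p i).value ψ) (μ ψ)) :=
  ⟨fun _ hφ B _ μ => μ.exists_hasSum_types (hφ.not_isBinaryTree A B),
    fun _ hT' μ => μ.exists_hasSum_types (hT'.not_isBinaryTree A)⟩
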